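/- **Setting.** Fix countable sets of object symbols, constant symbols, function symbols and variables; in addition there is a zero constant $0_{u,v}$ and there are arithmetic function symbols $-_{u,v},+_{u,v},\cdot_{u,v,w}$ for all object symbols $u,v,w$. A *signature* $\Sigma=(O,C,F,\sigma)$ consists of a set $O$ of object symbols, a set $C$ of constants containing all $0_{u,v}$ ($u,v\in O$), a set $F$ of function symbols containing all $-_{u,v},+_{u,v},\cdot_{u,v,w}$ ($u,v,w\in O$), and a sort function $\sigma$ assigning to each variable and each $c\in C$ a sort in $O\times O$ and to each $f\in F$ a sort $(u_1,v_1)\times\dots\times(u_n,v_n)\to(u,v)$ with $n\ge 1$ and all entries in $O\times O$, such that $\sigma(0_{u,v})=(u,v)$, $\sigma(-_{u,v})=(u,v)\to(u,v)$, $\sigma(+_{u,v})=(u,v)\times(u,v)\to(u,v)$ and $\sigma(\cdot_{u,v,w})=(w,v)\times(u,w)\to(u,v)$; as usual, every sort in $O\times O$ has infinitely many variables. Terms are the well-sorted terms over $\Sigma$; formulas are built from equations $s\approx t$ between terms of equal sort by $\lnot,\vee,\wedge,\rightarrow,\exists x,\forall x$; a sentence is a formula without free variables. A structure has a non-empty domain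 for each sort and interprets the symbols according to their sorts; $\Phi\models\varphi$ means that every interpretation (structure with an assignment of the variables) that is a model of $\Phi$ is a model of $\varphi$. $\Phi\vdash\varphi$ means that for some finite $\{\chi_1,\dots,\chi_m\}\subseteq\Phi$ the sequent $\chi_1,\dots,\chi_m\vdash\varphi$ is derivable in the following calculus LK$^=$ on pairs of finite multisets of formulas ($\varphi[x\mapsto t]$ is capture-avoiding substitution, $\sigma(t)=\sigma(x)$): - axioms $\Gamma,s\approx t\vdash\Delta,s\approx t$ and $\Gamma\vdash\Delta,t\approx t$; - weakening and contraction on both sides; - the left and right rules for the connectives: from $\Gamma\vdash\Delta,\varphi$ infer $\Gamma,\lnot\varphi\vdash\Delta$; from $\Gamma,\varphi\vdash\Delta$ infer $\Gamma\vdash\Delta,\lnot\varphi$; from $\Gamma,\varphi\vdash\Delta$ and $\Gamma,\psi\vdash\Delta$ infer $\Gamma,\varphi\vee\psi\vdash\Delta$; from $\Gamma\vdash\Delta,\varphi,\psi$ infer $\Gamma\vdash\Delta,\varphi\vee\psi$; from $\Gamma,\varphi,\psi\vdash\Delta$ infer $\Gamma,\varphi\wedge\psi\vdash\Delta$; from $\Gamma\vdash\Delta,\varphi$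 and $\Gamma\vdash\Delta,\psi$ infer $\Gamma\vdash\Delta,\varphi\wedge\psi$; from $\Gamma\vdash\Delta,\varphi$ and $\Gamma,\psi\vdash\Delta$ infer $\Gamma,\varphi\rightarrow\psi\vdash\Delta$; from $\Gamma,\varphi\vdash\Delta,\psi$ infer $\Gamma\vdash\Delta,\varphi\rightarrow\psi$; - from $\Gamma,\varphi[x\mapsto t]\vdash\Delta$ infer $\Gamma,\forall x\colon\varphi\vdash\Delta$; from $\Gamma\vdash\Delta,\varphi[x\mapsto t]$ infer $\Gamma\vdash\Delta,\exists x\colon\varphi$; and, if $y$ is a variable of the sort of $x$ that does not occur in the conclusion, from $\Gamma,\varphi[x\mapsto y]\vdash\Delta$ infer $\Gamma,\exists x\colon\varphi\vdash\Delta$, and from $\Gamma\vdash\Delta,\varphi[x\mapsto y]$ infer $\Gamma\vdash\Delta,\forall x\colon\varphi$; - substitution of equals on either side, for $\sigma(s)=\sigma(t)=\sigma(x)$: from $\Gamma,\varphi[x\mapsto t],s\approx t\vdash\Delta$ infer $\Gamma,\varphi[x\mapsto s],s\approx t\vdash\Delta$; from $\Gamma,s\approx t\vdash\Delta,\varphi[x\mapsto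 t]$ infer $\Gamma,s\approx t\vdash\Delta,\varphi[x\mapsto s]$. A sentence $P_1x_1\dots P_nx_n\colon\varphi^*$ ($n\ge 0$) with $\varphi^*$ quantifier-free is in Skolem normal form if all $P_i$ are $\forall$, and in Herbrand normal form if all $P_i$ are $\exists$. Its Herbrand expansion $H(\varphi)$ is the set of all $\varphi^*[x_1\mapsto t_1,\dots,x_n\mapsto t_n]$ with $t_i$ a variable-free term over $\Sigma$ of sort $\sigma(x_i)$ (so $H(\varphi)=\{\varphi\}$ if $n=0$), and $H(\Phi)=\bigcup_{\psi\in\Phi}H(\psi)$. **Corollary (many-sorted Herbrand theorem).** Let $\Phi$ be a set of sentences over $\Sigma$ in Skolem normal form and let $\varphi$ be a sentence over $\Sigma$ in Herbrand normal form. The following are equivalent: 1. $\Phi\models\varphi$. 2. There exist $k\ge 0$, $l\ge 1$, $\psi_1,\dots,\psi_k\in H(\Phi)$ and $\varphi_1,\dots,\varphi_l\in H(\varphi)$ such that $\psi_1\wedge\dots\wedge\psi_k\vdash\varphi_1\vee\dots\vee\varphi_l$ (for $k=0$: $\emptyset\vdash\varphi_1\vee\dots\vee\varphi_l$). -/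

import Mathlib

/-! Many-sorted first-order logic with equality, sorts being pairs of object symbols. -/

universe u

namespace OpLogic

/-- Constant symbols: ordinary ones `c_n`, and a zero constant `0_{u,v}` for all object
symbols `u, v`.  Object symbols, function symbols and variables are indexed by `ℕ`. -/
inductive ConstSym : Type
  | con (n : ℕ)
  | zero (u v : ℕ)

/-- Function symbols: ordinary ones `f_n`, and the arithmetic symbols
`-_{u,v}`, `+_{u,v}`, `·_{u,v,w}`. -/
inductive FunSym : Type
  | fn (n : ℕ)
  | neg (u v : ℕ)
  | add (u v : ℕ)
  | mul (u v w : ℕ)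

/-- The pair of object symbols underlying a sort. -/
def rawSort {O : Set ℕ} (p : O × O) : ℕ × ℕ := (p.1, p.2)

/-- A signature `(O, C, F, σ)`.  The sort function is split into its restrictions to variables,
constant symbols and function symbols; a function symbol `f` has sort
`funArgs f → funOut f` with at least one argument. -/
structure Signature where
  O : Set ℕ
  C : Set ConstSym
  F : Set FunSym
  zero_mem : ∀ u ∈ O, ∀ v ∈ O, ConstSym.zero u v ∈ C
  neg_mem : ∀ u ∈ O, ∀ v ∈ O, FunSym.neg u v ∈ F
  add_mem : ∀ u ∈ O, ∀ v ∈ O, FunSym.add u v ∈ F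
  mul_mem : ∀ u ∈ O, ∀ v ∈ O, ∀ w ∈ O, FunSym.mul u v w ∈ F
  varSort : ℕ → O × O
  constSort : C → O × O
  funArgs : F → List (O × O)
  funOut : F → O × O
  funArgs_ne_nil : ∀ f, funArgs f ≠ []
  zero_sort : ∀ u v (h : ConstSym.zero u v ∈ C), rawSort (constSort ⟨_, h⟩) = (u, v)
  neg_sort : ∀ u v (h : FunSym.neg u v ∈ F),
    (funArgs ⟨_, h⟩).map rawSort = [(u, v)] ∧ rawSort (funOut ⟨_, h⟩) = (u, v)
  add_sort : ∀ u v (h : FunSym.add u v ∈ F),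
    (funArgs ⟨_, h⟩).map rawSort = [(u, v), (u, v)] ∧ rawSort (funOut ⟨_, h⟩) = (u, v)
  mul_sort : ∀ u v w (h : FunSym.mul u v w ∈ F),
    (funArgs ⟨_, h⟩).map rawSort = [(w, v), (u, w)] ∧ rawSort (funOut ⟨_, h⟩) = (u, v)
  /-- The usual convention that every sort has an unlimited supply of variables, without which
  bound variables cannot be renamed. -/
  var_infinite : ∀ s : O × O, {x : ℕ | varSort x = s}.Infinite

namespace Signature

/-- The sorts of the signature. -/
abbrev Srt (S : Signature) : Type := S.O × S.O

theorem exists_fresh (S : Signature) (s : S.Srt) (A : Finset ℕ) :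
    ∃ y, S.varSort y = s ∧ y ∉ A := by
  obtain ⟨y, hy, hA⟩ := (S.var_infinite s).exists_notMem_finset A
  exact ⟨y, hy, hA⟩

open Classical in
/-- The first variable of sort `s` outside the finite set `A`. -/
noncomputable def fresh (S : Signature) (s : S.Srt) (A : Finset ℕ) : ℕ :=
  Nat.find (S.exists_fresh s A)

open Classical in
theorem varSort_fresh (S : Signature) (s : S.Srt) (A : Finset ℕ) :
    S.varSort (S.fresh s A) = s :=
  (Nat.find_spec (S.exists_fresh s A)).1

end Signature

/-- Terms, indexed by their sort. -/
inductive Term (S : Signature) : S.Srt → Type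
  | var (x : ℕ) : Term S (S.varSort x)
  | const (c : S.C) : Term S (S.constSort c)
  | func (f : S.F) (ts : ∀ i : Fin (S.funArgs f).length, Term S ((S.funArgs f).get i)) :
      Term S (S.funOut f)

/-- Formulas. The only predicate is equality between terms of the same sort. -/
inductive Formula (S : Signature) : Type
  | eq {s : S.Srt} (t₁ t₂ : Term S s) : Formula S
  | neg (φ : Formula S) : Formula S
  | or (φ ψ : Formula S) : Formula S
  | and (φ ψ : Formula S) : Formula S
  | imp (φ ψ : Formula S) : Formula S
  | ex (x : ℕ) (φ : Formula S) : Formula S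
  | all (x : ℕ) (φ : Formula S) : Formula S

/-- A sort-preserving map from variables to terms. -/
abbrev Subst (S : Signature) : Type := ∀ x : ℕ, Term S (S.varSort x)

namespace Term

variable {S : Signature}

/-- The variables occurring in a term. -/
def vars : {s : S.Srt} → Term S s → Finset ℕ
  | _, var x => {x}
  | _, const _ => ∅
  | _, func _ ts => Finset.univ.biUnion fun i => vars (ts i)

/-- A ground term has no variables. -/
def IsGround {s : S.Srt} (t : Term S s) : Prop := t.vars = ∅

/-- Simultaneous substitution in a term. -/
def subst (θ : Subst S) : {s : S.Srt} → Term S s → Term S s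
  | _, var x => θ x
  | _, const c => const c
  | _, func f ts => func f fun i => subst θ (ts i)

/-- A variable of sort `s`, as a term of sort `s`. -/
def varOf {s : S.Srt} (y : ℕ) (h : S.varSort y = s) : Term S s := h ▸ var y

end Term

namespace Formula

variable {S : Signature}

/-- The free variables of a formula. -/
def fv : Formula S → Finset ℕ
  | eq t₁ t₂ => t₁.vars ∪ t₂.vars
  | neg φ => fv φ
  | or φ ψ => fv φ ∪ fv ψ
  | and φ ψ => fv φ ∪ fv ψ
  | imp φ ψ => fv φ ∪ fv ψ
  | ex x φ => (fv φ).erase x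
  | all x φ => (fv φ).erase x

/-- All variables occurring in a formula, free, bound or in a quantifier. -/
def occ : Formula S → Finset ℕ
  | eq t₁ t₂ => t₁.vars ∪ t₂.vars
  | neg φ => occ φ
  | or φ ψ => occ φ ∪ occ ψ
  | and φ ψ => occ φ ∪ occ ψ
  | imp φ ψ => occ φ ∪ occ ψ
  | ex x φ => insert x (occ φ)
  | all x φ => insert x (occ φ)

/-- Sentences have no free variables. -/
def IsSentence (φ : Formula S) : Prop := φ.fv = ∅

/-- Quantifier-free formulas. -/
def QuantifierFree : Formula S → Prop
  | eq _ _ => True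
  | neg φ => QuantifierFree φ
  | or φ ψ => QuantifierFree φ ∧ QuantifierFree ψ
  | and φ ψ => QuantifierFree φ ∧ QuantifierFree ψ
  | imp φ ψ => QuantifierFree φ ∧ QuantifierFree ψ
  | ex _ _ => False
  | all _ _ => False

/-- The variables that `θ` brings into the scope of a quantifier `Q x` with body `φ`. -/
def incoming (θ : Subst S) (x : ℕ) (φ : Formula S) : Finset ℕ :=
  (φ.fv.erase x).biUnion fun z => (θ z).vars

/-- The bound variable to use after substituting `θ` in `Q x : φ`: it is `x` itself unless `x`
would capture a variable, in which case it is the first new variable of the same sort. -/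
noncomputable def binder (θ : Subst S) (x : ℕ) (φ : Formula S) : ℕ :=
  if x ∈ incoming θ x φ then S.fresh (S.varSort x) (φ.occ ∪ incoming θ x φ) else x

theorem varSort_binder (θ : Subst S) (x : ℕ) (φ : Formula S) :
    S.varSort (binder θ x φ) = S.varSort x := by
  unfold binder
  split_ifs
  · exact S.varSort_fresh _ _
  · rfl

/-- The substitution to apply to the body `φ` of `Q x : φ`. -/
noncomputable def under (θ : Subst S) (x : ℕ) (φ : Formula S) : Subst S :=
  Function.update θ x (Term.varOf (binder θ x φ) (varSort_binder θ x φ))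

/-- Simultaneous capture-avoiding substitution for the free variables of a formula. -/
noncomputable def substAll (θ : Subst S) : Formula S → Formula S
  | eq t₁ t₂ => eq (t₁.subst θ) (t₂.subst θ)
  | neg φ => neg (substAll θ φ)
  | or φ ψ => or (substAll θ φ) (substAll θ ψ)
  | and φ ψ => and (substAll θ φ) (substAll θ ψ)
  | imp φ ψ => imp (substAll θ φ) (substAll θ ψ)
  | ex x φ => ex (binder θ x φ) (substAll (under θ x φ) φ)
  | all x φ => all (binder θ x φ) (substAll (under θ x φ) φ)

/-- `φ[x ↦ t]`. -/
noncomputable def subst (φ : Formula S) (x : ℕ) (t : Term S (S.varSort x)) : Formula S :=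
  φ.substAll (Function.update Term.var x t)

end Formula

/-! ### Semantics -/

/-- Structures: non-empty domains with constants and functions of the right sorts. -/
structure Structure (S : Signature) where
  carrier : S.Srt → Type u
  nonempty : ∀ s, Nonempty (carrier s)
  const : ∀ c : S.C, carrier (S.constSort c)
  func : ∀ f : S.F, (∀ i : Fin (S.funArgs f).length, carrier ((S.funArgs f).get i)) →
    carrier (S.funOut f)

/-- Assignments of elements to variables, respecting sorts. -/
abbrev Assignment {S : Signature} (A : Structure.{u} S) : Type u :=
  ∀ x : ℕ, A.carrier (S.varSort x)

/-- The interpretation of a term. -/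
def Term.eval {S : Signature} (A : Structure.{u} S) (M : Assignment A) :
    {s : S.Srt} → Term S s → A.carrier s
  | _, .var x => M x
  | _, .const c => A.const c
  | _, .func f ts => A.func f fun i => Term.eval A M (ts i)

/-- The interpretation `(A, M)` is a model of the formula. -/
def Formula.Holds {S : Signature} (A : Structure.{u} S) : Assignment A → Formula S → Prop
  | M, .eq t₁ t₂ => t₁.eval A M = t₂.eval A M
  | M, .neg φ => ¬ Holds A M φ
  | M, .or φ ψ => Holds A M φ ∨ Holds A M ψ
  | M, .and φ ψ => Holds A M φ ∧ Holds A M ψ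
  | M, .imp φ ψ => Holds A M φ → Holds A M ψ
  | M, .ex x φ => ∃ a : A.carrier (S.varSort x), Holds A (Function.update M x a) φ
  | M, .all x φ => ∀ a : A.carrier (S.varSort x), Holds A (Function.update M x a) φ

/-- Semantic consequence `Φ ⊨ φ`. -/
def Entails {S : Signature} (Φ : Set (Formula S)) (φ : Formula S) : Prop :=
  ∀ (A : Structure.{u} S) (M : Assignment A), (∀ ψ ∈ Φ, ψ.Holds A M) → φ.Holds A M

/-! ### The sequent calculus -/

/-- `y` occurs in no formula of the multiset. -/
def NewFor {S : Signature} (y : ℕ) (Γ : Multiset (Formula S)) : Prop := ∀ φ ∈ Γ, y ∉ φ.occ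

/-- Derivability of sequents in the (cut-free) calculus LK with equality. -/
inductive Derivable {S : Signature} : Multiset (Formula S) → Multiset (Formula S) → Prop
  | ax (Γ Δ : Multiset (Formula S)) {s : S.Srt} (t₁ t₂ : Term S s) :
      Derivable (Formula.eq t₁ t₂ ::ₘ Γ) (Formula.eq t₁ t₂ ::ₘ Δ)
  | ref (Γ Δ : Multiset (Formula S)) {s : S.Srt} (t : Term S s) :
      Derivable Γ (Formula.eq t t ::ₘ Δ)
  | weakL {Γ Δ : Multiset (Formula S)} (φ : Formula S) :
      Derivable Γ Δ → Derivable (φ ::ₘ Γ) Δ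
  | weakR {Γ Δ : Multiset (Formula S)} (φ : Formula S) :
      Derivable Γ Δ → Derivable Γ (φ ::ₘ Δ)
  | contrL {Γ Δ : Multiset (Formula S)} (φ : Formula S) :
      Derivable (φ ::ₘ φ ::ₘ Γ) Δ → Derivable (φ ::ₘ Γ) Δ
  | contrR {Γ Δ : Multiset (Formula S)} (φ : Formula S) :
      Derivable Γ (φ ::ₘ φ ::ₘ Δ) → Derivable Γ (φ ::ₘ Δ)
  | negL {Γ Δ : Multiset (Formula S)} (φ : Formula S) :
      Derivable Γ (φ ::ₘ Δ) → Derivable (φ.neg ::ₘ Γ) Δ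
  | negR {Γ Δ : Multiset (Formula S)} (φ : Formula S) :
      Derivable (φ ::ₘ Γ) Δ → Derivable Γ (φ.neg ::ₘ Δ)
  | orL {Γ Δ : Multiset (Formula S)} (φ ψ : Formula S) :
      Derivable (φ ::ₘ Γ) Δ → Derivable (ψ ::ₘ Γ) Δ → Derivable (φ.or ψ ::ₘ Γ) Δ
  | orR {Γ Δ : Multiset (Formula S)} (φ ψ : Formula S) :
      Derivable Γ (φ ::ₘ ψ ::ₘ Δ) → Derivable Γ (φ.or ψ ::ₘ Δ)
  | andL {Γ Δ : Multiset (Formula S)} (φ ψ : Formula S) :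
      Derivable (φ ::ₘ ψ ::ₘ Γ) Δ → Derivable (φ.and ψ ::ₘ Γ) Δ
  | andR {Γ Δ : Multiset (Formula S)} (φ ψ : Formula S) :
      Derivable Γ (φ ::ₘ Δ) → Derivable Γ (ψ ::ₘ Δ) → Derivable Γ (φ.and ψ ::ₘ Δ)
  | impL {Γ Δ : Multiset (Formula S)} (φ ψ : Formula S) :
      Derivable Γ (φ ::ₘ Δ) → Derivable (ψ ::ₘ Γ) Δ → Derivable (φ.imp ψ ::ₘ Γ) Δ
  | impR {Γ Δ : Multiset (Formula S)} (φ ψ : Formula S) :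
      Derivable (φ ::ₘ Γ) (ψ ::ₘ Δ) → Derivable Γ (φ.imp ψ ::ₘ Δ)
  | exL {Γ Δ : Multiset (Formula S)} (x : ℕ) (φ : Formula S) (y : ℕ)
      (hy : S.varSort y = S.varSort x) (hL : NewFor y (φ.ex x ::ₘ Γ)) (hR : NewFor y Δ) :
      Derivable (φ.subst x (Term.varOf y hy) ::ₘ Γ) Δ → Derivable (φ.ex x ::ₘ Γ) Δ
  | exR {Γ Δ : Multiset (Formula S)} (x : ℕ) (φ : Formula S) (t : Term S (S.varSort x)) :
      Derivable Γ (φ.subst x t ::ₘ Δ) → Derivable Γ (φ.ex x ::ₘ Δ)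
  | allL {Γ Δ : Multiset (Formula S)} (x : ℕ) (φ : Formula S) (t : Term S (S.varSort x)) :
      Derivable (φ.subst x t ::ₘ Γ) Δ → Derivable (φ.all x ::ₘ Γ) Δ
  | allR {Γ Δ : Multiset (Formula S)} (x : ℕ) (φ : Formula S) (y : ℕ)
      (hy : S.varSort y = S.varSort x) (hL : NewFor y Γ) (hR : NewFor y (φ.all x ::ₘ Δ)) :
      Derivable Γ (φ.subst x (Term.varOf y hy) ::ₘ Δ) → Derivable Γ (φ.all x ::ₘ Δ)
  | subL {Γ Δ : Multiset (Formula S)} (x : ℕ) (φ : Formula S) (s t : Term S (S.varSort x)) :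
      Derivable (φ.subst x t ::ₘ Formula.eq s t ::ₘ Γ) Δ →
      Derivable (φ.subst x s ::ₘ Formula.eq s t ::ₘ Γ) Δ
  | subR {Γ Δ : Multiset (Formula S)} (x : ℕ) (φ : Formula S) (s t : Term S (S.varSort x)) :
      Derivable (Formula.eq s t ::ₘ Γ) (φ.subst x t ::ₘ Δ) →
      Derivable (Formula.eq s t ::ₘ Γ) (φ.subst x s ::ₘ Δ)

/-- `Φ ⊢ φ`: provability by a formal computation from a set of formulas. -/
def Provable {S : Signature} (Φ : Set (Formula S)) (φ : Formula S) : Prop :=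
  ∃ L : Finset (Formula S), (L : Set (Formula S)) ⊆ Φ ∧ Derivable L.val {φ}

/-! ### Normal forms and Herbrand expansions -/

/-- Skolem normal form: a block of universal quantifiers before a quantifier-free formula. -/
inductive IsSkolem {S : Signature} : Formula S → Prop
  | qf {φ : Formula S} : φ.QuantifierFree → IsSkolem φ
  | all {φ : Formula S} (x : ℕ) : IsSkolem φ → IsSkolem (φ.all x)

/-- Herbrand normal form: a block of existential quantifiers before a quantifier-free formula. -/
inductive IsHerbrand {S : Signature} : Formula S → Prop
  | qf {φ : Formula S} : φ.QuantifierFree → IsHerbrand φ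
  | ex {φ : Formula S} (x : ℕ) : IsHerbrand φ → IsHerbrand (φ.ex x)

/-- The formula left after removing the leading quantifiers. -/
def Formula.matrix {S : Signature} : Formula S → Formula S
  | .ex _ φ => φ.matrix
  | .all _ φ => φ.matrix
  | φ => φ

/-- The variables of the leading quantifiers. -/
def Formula.prefixVars {S : Signature} : Formula S → List ℕ
  | .ex x φ => x :: φ.prefixVars
  | .all x φ => x :: φ.prefixVars
  | _ => []

/-- The Herbrand expansion of a prenex formula: all instances of its matrix in which the
variables of the prefix (and no others) are replaced by ground terms of the same sort. -/
def herbrand {S : Signature} (φ : Formula S) : Set (Formula S) :=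
  {ψ | ∃ θ : Subst S, (∀ x ∈ φ.prefixVars, (θ x).IsGround) ∧
    (∀ x ∉ φ.prefixVars, θ x = Term.var x) ∧ ψ = φ.matrix.substAll θ}

/-- The Herbrand expansion of a set of prenex formulas. -/
def herbrandSet {S : Signature} (Φ : Set (Formula S)) : Set (Formula S) :=
  ⋃ φ ∈ Φ, herbrand φ

/-- `{ψ₁ ∧ … ∧ ψ_k}`, and the empty set of premises if `k = 0`. -/
def conjPremise {S : Signature} : List (Formula S) → Set (Formula S)
  | [] => ∅
  | ψ :: l => {l.foldl Formula.and ψ}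

/-- `φ ∨ φ₂ ∨ … ∨ φ_l`, where `l` lists `φ₂, …, φ_l`. -/
def disj {S : Signature} (φ : Formula S) (l : List (Formula S)) : Formula S :=
  l.foldl Formula.or φ

end OpLogic

namespace OpLogic

variable {S : Signature}

/-! ### Substitution in terms and quantifier-free formulas -/

/-! From 2 to 1: the calculus has no cut, so a derivation with a quantifier-free end sequent
contains only quantifier-free formulas and its soundness needs no quantifier rule
(`Derivable.sound`). A model of a Skolem sentence satisfies all its instances, and any true instance
of a Herbrand sentence makes the sentence true.

From 1 to 2, by contraposition: if no sequent from `herbrandSet Φ` to `herbrand φ` is derivable,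
extend the two sets to a maximal underivable pair `L`, `R`. Maximality makes the pair closed under
the rules read upwards, and the ground terms modulo the congruence generated by the equations in `L`
form a model of `Φ` that refutes `φ` (`Saturated.truth`).

The delicate point is that an equation of `R` must fail in this model. Without cut, an equation `s ≈
t` of `L` only allows `s` to be replaced by `t`, so symmetry and transitivity are not at hand.
Instead the equations of `L` are read as rewrite rules. They rewrite their own left-hand sides,
which makes rewriting strongly confluent, so congruent terms have a common reduct `z`. Rewriting
both sides of an equation of `R` then puts `z ≈ z` into `R`, against the reflexivity axiom. -/

theorem Term.subst_congr {θ θ' : Subst S} {s : S.Srt} (t : Term S s)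
    (h : ∀ x ∈ t.vars, θ x = θ' x) : t.subst θ = t.subst θ' := by
  induction t with
  | var x => exact h x (by simp [vars])
  | const c => rfl
  | func f ts ih =>
    simp only [subst]
    congr 1
    funext i
    exact ih i fun x hx => h x (by simp only [vars, Finset.mem_biUnion]; exact ⟨i, by simp, hx⟩)

theorem Term.subst_var {s : S.Srt} (t : Term S s) : t.subst Term.var = t := by
  induction t with
  | var x => rfl
  | const c => rfl
  | func f ts ih => simp only [subst, ih]

theorem Term.subst_update_of_notMem {s : S.Srt} (t : Term S s) {x : ℕ} (hx : x ∉ t.vars)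
    (a : Term S (S.varSort x)) : t.subst (Function.update Term.var x a) = t := by
  refine (t.subst_congr fun y hy => ?_).trans t.subst_var
  exact Function.update_of_ne (by rintro rfl; exact hx hy) _ _

theorem Term.isGround_func {f : S.F}
    {ts : ∀ i : Fin (S.funArgs f).length, Term S ((S.funArgs f).get i)} :
    (Term.func f ts).IsGround ↔ ∀ i, (ts i).IsGround := by
  simp only [IsGround, vars, Finset.eq_empty_iff_forall_notMem, Finset.mem_biUnion,
    Finset.mem_univ, true_and, not_exists]
  exact forall_comm

theorem Term.isGround_subst {θ : Subst S} (hθ : ∀ x, (θ x).IsGround) {s : S.Srt}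
    (t : Term S s) : (t.subst θ).IsGround := by
  induction t with
  | var x => exact hθ x
  | const c => rfl
  | func f ts ih => exact isGround_func.2 ih

/-- The zero constants supply a ground term in each sort. This keeps the Herbrand expansions and the
domains of the term model non-empty. -/
theorem exists_isGround (s : S.Srt) : ∃ t : Term S s, t.IsGround := by
  have hz := S.zero_mem s.1 s.1.2 s.2 s.2.2
  have h : S.constSort ⟨_, hz⟩ = s := by
    have := S.zero_sort _ _ hz
    simp only [rawSort, Prod.mk.injEq] at this
    exact Prod.ext (Subtype.ext this.1) (Subtype.ext this.2)
  exact h ▸ ⟨Term.const ⟨_, hz⟩, rfl⟩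

theorem Term.eval_subst (A : Structure.{u} S) (M : Assignment A) (θ : Subst S) {s : S.Srt}
    (t : Term S s) : (t.subst θ).eval A M = t.eval A fun x => (θ x).eval A M := by
  induction t with
  | var x => rfl
  | const c => rfl
  | func f ts ih => simp only [subst, eval, ih]

namespace Formula

theorem QuantifierFree.substAll_congr {θ θ' : Subst S} {φ : Formula S} (hφ : φ.QuantifierFree)
    (h : ∀ x ∈ φ.fv, θ x = θ' x) : φ.substAll θ = φ.substAll θ' := by
  induction φ with
  | eq a b =>
    simp only [substAll, fv, Finset.mem_union] at h ⊢
    rw [a.subst_congr fun x hx => h x (.inl hx), b.subst_congr fun x hx => h x (.inr hx)]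
  | neg φ ih => simp only [substAll, ih hφ h]
  | or φ ψ ih₁ ih₂ | and φ ψ ih₁ ih₂ | imp φ ψ ih₁ ih₂ =>
    simp only [fv, Finset.mem_union] at h
    simp only [substAll, ih₁ hφ.1 fun x hx => h x (.inl hx), ih₂ hφ.2 fun x hx => h x (.inr hx)]
  | ex x φ | all x φ => exact hφ.elim

theorem quantifierFree_substAll {θ : Subst S} {φ : Formula S} :
    (φ.substAll θ).QuantifierFree ↔ φ.QuantifierFree := by
  induction φ with
  | eq a b => rfl
  | neg φ ih => exact ih
  | or φ ψ ih₁ ih₂ | and φ ψ ih₁ ih₂ | imp φ ψ ih₁ ih₂ => exact and_congr ih₁ ih₂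
  | ex x φ | all x φ => rfl

theorem QuantifierFree.holds_substAll (A : Structure.{u} S) (M : Assignment A) (θ : Subst S)
    {φ : Formula S} (hφ : φ.QuantifierFree) :
    (φ.substAll θ).Holds A M ↔ φ.Holds A fun x => (θ x).eval A M := by
  induction φ with
  | eq a b => simp only [substAll, Holds, Term.eval_subst]
  | neg φ ih => simp only [substAll, Holds, ih hφ]
  | or φ ψ ih₁ ih₂ | and φ ψ ih₁ ih₂ | imp φ ψ ih₁ ih₂ =>
    simp only [substAll, Holds, ih₁ hφ.1, ih₂ hφ.2]
  | ex x φ | all x φ => exact hφ.elim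

theorem QuantifierFree.holds_subst_congr {A : Structure.{u} S} {M : Assignment A} {x : ℕ}
    {a b : Term S (S.varSort x)} (hab : a.eval A M = b.eval A M) {φ : Formula S}
    (hφ : φ.QuantifierFree) : (φ.subst x a).Holds A M ↔ (φ.subst x b).Holds A M := by
  simp only [subst, hφ.holds_substAll]
  have : (fun y => (Function.update Term.var x a y).eval A M) =
      fun y => (Function.update Term.var x b y).eval A M := by
    funext y
    rcases eq_or_ne y x with rfl | hy
    · simpa using hab
    · simp [hy]
  rw [this]

theorem matrix_eq_self {φ : Formula S} (hφ : φ.QuantifierFree) : φ.matrix = φ := by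
  cases φ <;> first | rfl | exact hφ.elim

theorem prefixVars_eq_nil {φ : Formula S} (hφ : φ.QuantifierFree) : φ.prefixVars = [] := by
  cases φ <;> first | rfl | exact hφ.elim

theorem fv_matrix_subset (φ : Formula S) : ∀ x ∈ φ.matrix.fv, x ∈ φ.fv ∨ x ∈ φ.prefixVars := by
  induction φ with
  | ex y φ ih | all y φ ih =>
    intro x hx
    simp only [fv, prefixVars, Finset.mem_erase, List.mem_cons]
    have := ih x hx
    tauto
  | _ => exact fun x hx => .inl hx

end Formula

/-! ### Truth of prenex formulas and of their instances -/

theorem IsSkolem.quantifierFree_matrix {φ : Formula S} (h : IsSkolem φ) :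
    φ.matrix.QuantifierFree := by
  induction h with
  | qf h => rwa [Formula.matrix_eq_self h]
  | all x _ ih => exact ih

theorem IsHerbrand.quantifierFree_matrix {φ : Formula S} (h : IsHerbrand φ) :
    φ.matrix.QuantifierFree := by
  induction h with
  | qf h => rwa [Formula.matrix_eq_self h]
  | ex x _ ih => exact ih

/-- The quantifier block amounts to one change of assignment on all prefix variables. A repeated
variable does no harm, since its innermost quantifier overrides the others. -/
theorem IsSkolem.holds_iff {A : Structure.{u} S} {φ : Formula S} (h : IsSkolem φ)
    (M : Assignment A) :
    φ.Holds A M ↔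
      ∀ M' : Assignment A, (∀ x ∉ φ.prefixVars, M' x = M x) → φ.matrix.Holds A M' := by
  induction h generalizing M with
  | qf h =>
    rw [Formula.matrix_eq_self h, Formula.prefixVars_eq_nil h]
    refine ⟨fun hM M' hM' => ?_, fun hM => hM M fun _ _ => rfl⟩
    rwa [show M' = M from funext fun x => hM' x (by simp)]
  | @all φ y _ ih =>
    simp only [Formula.Holds, Formula.matrix, Formula.prefixVars, List.mem_cons, not_or, ih]
    constructor
    · intro H M' hM'
      refine H (M' y) M' fun x hx => ?_
      rcases eq_or_ne x y with rfl | hxy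
      · simp
      · rw [Function.update_of_ne hxy]
        exact hM' x ⟨hxy, hx⟩
    · intro H a M' hM'
      refine H M' fun x hx => ?_
      rw [hM' x hx.2, Function.update_of_ne hx.1]

theorem IsHerbrand.holds_iff {A : Structure.{u} S} {φ : Formula S} (h : IsHerbrand φ)
    (M : Assignment A) :
    φ.Holds A M ↔
      ∃ M' : Assignment A, (∀ x ∉ φ.prefixVars, M' x = M x) ∧ φ.matrix.Holds A M' := by
  induction h generalizing M with
  | qf h =>
    rw [Formula.matrix_eq_self h, Formula.prefixVars_eq_nil h]
    refine ⟨fun hM => ⟨M, fun _ _ => rfl, hM⟩, fun ⟨M', hM', hM⟩ => ?_⟩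
    rwa [show M' = M from funext fun x => hM' x (by simp)] at hM
  | @ex φ y _ ih =>
    simp only [Formula.Holds, Formula.matrix, Formula.prefixVars, List.mem_cons, not_or, ih]
    constructor
    · rintro ⟨a, M', hM', H⟩
      refine ⟨M', fun x hx => ?_, H⟩
      rw [hM' x hx.2, Function.update_of_ne hx.1]
    · rintro ⟨M', hM', H⟩
      refine ⟨M' y, M', fun x hx => ?_, H⟩
      rcases eq_or_ne x y with rfl | hxy
      · simp
      · rw [Function.update_of_ne hxy]
        exact hM' x ⟨hxy, hx⟩

theorem IsSkolem.holds_of_mem_herbrand {A : Structure.{u} S} {M : Assignment A} {φ ψ : Formula S}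
    (h : IsSkolem φ) (hM : φ.Holds A M) (hψ : ψ ∈ herbrand φ) : ψ.Holds A M := by
  obtain ⟨θ, -, hθ, rfl⟩ := hψ
  rw [h.quantifierFree_matrix.holds_substAll]
  exact (h.holds_iff M).1 hM _ fun x hx => by rw [hθ x hx]; rfl

theorem IsHerbrand.holds_of_mem_herbrand {A : Structure.{u} S} {M : Assignment A}
    {φ ψ : Formula S} (h : IsHerbrand φ) (hψ : ψ ∈ herbrand φ) (hM : ψ.Holds A M) :
    φ.Holds A M := by
  obtain ⟨θ, -, hθ, rfl⟩ := hψ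
  rw [h.quantifierFree_matrix.holds_substAll] at hM
  exact (h.holds_iff M).2 ⟨_, fun x hx => by rw [hθ x hx]; rfl, hM⟩

/-- Substituting a ground term for every variable in the matrix of a sentence gives an element of
its Herbrand expansion. -/
theorem substAll_matrix_mem_herbrand {φ : Formula S} (hs : φ.IsSentence)
    (hq : φ.matrix.QuantifierFree) {θ : Subst S} (hθ : ∀ x, (θ x).IsGround) :
    φ.matrix.substAll θ ∈ herbrand φ := by
  -- The expansion demands the identity off the prefix. As `φ` is a sentence, its matrix has no free
  -- variable there, so this correction changes nothing.
  refine ⟨fun x => if x ∈ φ.prefixVars then θ x else Term.var x, fun x hx => ?_, fun x hx => ?_,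
    hq.substAll_congr fun x hx => ?_⟩
  · simpa [hx] using hθ x
  · simp [hx]
  · have := (φ.fv_matrix_subset x hx).resolve_left (by rw [hs]; simp)
    simp [this]

theorem herbrand_nonempty {φ : Formula S} (hs : φ.IsSentence)
    (hq : φ.matrix.QuantifierFree) : (herbrand φ).Nonempty := by
  choose g hg using fun s => exists_isGround (S := S) s
  exact ⟨_, substAll_matrix_mem_herbrand hs hq fun x => hg (S.varSort x)⟩

/-! ### Soundness for quantifier-free sequents -/

theorem exists_mem_cons {P : Formula S → Prop} {φ : Formula S} {Γ : Multiset (Formula S)} :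
    (∃ ψ ∈ φ ::ₘ Γ, P ψ) ↔ P φ ∨ ∃ ψ ∈ Γ, P ψ := by
  simp

/-- Each rule with a quantifier-free conclusion has quantifier-free premises, so the quantifier
rules are excluded and no eigenvariable argument is needed. The assignment stays fixed throughout.
-/
theorem Derivable.sound {Γ Δ : Multiset (Formula S)} (h : Derivable Γ Δ)
    (hΓ : ∀ φ ∈ Γ, φ.QuantifierFree) (hΔ : ∀ φ ∈ Δ, φ.QuantifierFree)
    (A : Structure.{u} S) (M : Assignment A) (hM : ∀ φ ∈ Γ, φ.Holds A M) :
    ∃ φ ∈ Δ, φ.Holds A M := by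
  have qsub : ∀ {φ : Formula S} {x a b}, (φ.subst x a).QuantifierFree →
      (φ.subst x b).QuantifierFree := fun h =>
    Formula.quantifierFree_substAll.2 (Formula.quantifierFree_substAll.1 h)
  induction h with
  | ax Γ Δ a b => exact ⟨_, Multiset.mem_cons_self _ _, hM _ (Multiset.mem_cons_self _ _)⟩
  | ref Γ Δ t => exact ⟨_, Multiset.mem_cons_self _ _, rfl⟩
  | exL x φ => exact (hΓ _ (Multiset.mem_cons_self _ _)).elim
  | allL x φ => exact (hΓ _ (Multiset.mem_cons_self _ _)).elim
  | exR x φ => exact (hΔ _ (Multiset.mem_cons_self _ _)).elim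
  | allR x φ => exact (hΔ _ (Multiset.mem_cons_self _ _)).elim
  | subL x φ a b _ ih =>
    simp only [Multiset.forall_mem_cons] at hΓ hM ih
    exact ih ⟨qsub hΓ.1, hΓ.2⟩ hΔ ⟨((Formula.quantifierFree_substAll.1 hΓ.1).holds_subst_congr
      hM.2.1).1 hM.1, hM.2⟩
  | subR x φ a b _ ih =>
    simp only [Multiset.forall_mem_cons, exists_mem_cons] at hΓ hM hΔ ih ⊢
    rw [(Formula.quantifierFree_substAll.1 hΔ.1).holds_subst_congr hM.1]
    exact ih hΓ ⟨qsub hΔ.1, hΔ.2⟩ hM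
  | _ =>
    simp only [Multiset.forall_mem_cons, exists_mem_cons, Formula.QuantifierFree,
      Formula.Holds] at *
    tauto

theorem quantifierFree_foldl_and {ψ : Formula S} {l : List (Formula S)}
    (h : ∀ χ ∈ ψ :: l, χ.QuantifierFree) : (l.foldl Formula.and ψ).QuantifierFree := by
  induction l generalizing ψ with
  | nil => simpa using h
  | cons χ l ih =>
    simp only [List.forall_mem_cons] at h ih
    exact ih ⟨⟨h.1, h.2.1⟩, h.2.2⟩

theorem quantifierFree_disj {ψ : Formula S} {l : List (Formula S)}
    (h : ∀ χ ∈ ψ :: l, χ.QuantifierFree) : (disj ψ l).QuantifierFree := by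
  induction l generalizing ψ with
  | nil => simpa [disj] using h
  | cons χ l ih =>
    simp only [List.forall_mem_cons] at h ih
    exact ih ⟨⟨h.1, h.2.1⟩, h.2.2⟩

theorem holds_foldl_and {A : Structure.{u} S} {M : Assignment A} {ψ : Formula S}
    {l : List (Formula S)} : (l.foldl Formula.and ψ).Holds A M ↔ ∀ χ ∈ ψ :: l, χ.Holds A M := by
  induction l generalizing ψ with
  | nil => simp
  | cons χ l ih => simp [ih, Formula.Holds, and_assoc]

theorem holds_disj {A : Structure.{u} S} {M : Assignment A} {ψ : Formula S}
    {l : List (Formula S)} : (disj ψ l).Holds A M ↔ ∃ χ ∈ ψ :: l, χ.Holds A M := by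
  unfold disj
  induction l generalizing ψ with
  | nil => simp
  | cons χ l ih => simp [ih, Formula.Holds, or_assoc]

/-- Soundness for a quantifier-free conclusion and a conjunction of quantifier-free premises. -/
theorem Provable.sound {ψs φs : List (Formula S)} {φ : Formula S}
    (h : Provable (conjPremise ψs) (disj φ φs)) (hψ : ∀ χ ∈ ψs, χ.QuantifierFree)
    (hφ : ∀ χ ∈ φ :: φs, χ.QuantifierFree) (A : Structure.{u} S) (M : Assignment A)
    (hM : ∀ χ ∈ ψs, χ.Holds A M) : ∃ χ ∈ φ :: φs, χ.Holds A M := by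
  obtain ⟨L, hL, hd⟩ := h
  have hprem : ∀ χ ∈ conjPremise ψs, χ.QuantifierFree ∧ χ.Holds A M := by
    cases ψs with
    | nil => simp [conjPremise]
    | cons ψ l =>
      rintro χ rfl
      exact ⟨quantifierFree_foldl_and hψ, holds_foldl_and.2 hM⟩
  obtain ⟨χ, hχ, hH⟩ := hd.sound (fun χ hχ => (hprem χ (hL hχ)).1)
    (by simpa using quantifierFree_disj hφ) A M fun χ hχ => (hprem χ (hL hχ)).2
  rw [Multiset.mem_singleton.1 hχ] at hH
  exact holds_disj.1 hH

/-! ### Structural properties of the calculus -/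

theorem Derivable.add_left {Γ Δ : Multiset (Formula S)} (h : Derivable Γ Δ)
    (Γ' : Multiset (Formula S)) : Derivable (Γ' + Γ) Δ := by
  induction Γ' using Multiset.induction with
  | empty => simpa
  | cons a Γ' ih => simpa using ih.weakL a

theorem Derivable.add_right {Γ Δ : Multiset (Formula S)} (h : Derivable Γ Δ)
    (Δ' : Multiset (Formula S)) : Derivable Γ (Δ' + Δ) := by
  induction Δ' using Multiset.induction with
  | empty => simpa
  | cons a Δ' ih => simpa using ih.weakR a

/-- Multiplicities do not matter: weakening adds the larger multiset, and contraction absorbs the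
smaller one into it. -/
theorem Derivable.mono {Γ Γ' Δ Δ' : Multiset (Formula S)} (h : Derivable Γ Δ)
    (hΓ : Γ ⊆ Γ') (hΔ : Δ ⊆ Δ') : Derivable Γ' Δ' := by
  have left : ∀ {Γ Γ' Δ : Multiset (Formula S)}, Γ ⊆ Γ' → Derivable (Γ + Γ') Δ →
      Derivable Γ' Δ := by
    intro Γ Γ' Δ hs hd
    induction Γ using Multiset.induction with
    | empty => simpa using hd
    | cons a Γ ih =>
      rw [Multiset.cons_subset] at hs
      obtain ⟨Γ'', rfl⟩ := Multiset.exists_cons_of_mem hs.1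
      refine ih hs.2 ?_
      simp only [Multiset.cons_add, Multiset.add_cons] at hd ⊢
      exact hd.contrL
  have right : ∀ {Γ Δ Δ' : Multiset (Formula S)}, Δ ⊆ Δ' → Derivable Γ (Δ + Δ') →
      Derivable Γ Δ' := by
    intro Γ Δ Δ' hs hd
    induction Δ using Multiset.induction with
    | empty => simpa using hd
    | cons a Δ ih =>
      rw [Multiset.cons_subset] at hs
      obtain ⟨Δ'', rfl⟩ := Multiset.exists_cons_of_mem hs.1
      refine ih hs.2 ?_
      simp only [Multiset.cons_add, Multiset.add_cons] at hd ⊢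
      exact hd.contrR
  refine right hΔ (left hΓ ?_)
  rw [add_comm Γ, add_comm Δ]
  exact (h.add_left Γ').add_right Δ'

theorem Derivable.foldl_and {ψ : Formula S} {l : List (Formula S)} {Δ : Multiset (Formula S)}
    (h : Derivable (ψ ::ₘ (l : Multiset (Formula S))) Δ) :
    Derivable {l.foldl Formula.and ψ} Δ := by
  induction l generalizing ψ with
  | nil => simpa using h
  | cons χ l ih => exact ih (.andL _ _ (by simpa using h))

theorem Derivable.disj {ψ : Formula S} {l : List (Formula S)} {Γ : Multiset (Formula S)}
    (h : Derivable Γ (ψ ::ₘ (l : Multiset (Formula S)))) :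
    Derivable Γ {disj ψ l} := by
  unfold OpLogic.disj
  induction l generalizing ψ with
  | nil => simpa using h
  | cons χ l ih => exact ih (.orR _ _ (by simpa using h))

theorem Derivable.provable {ψs φs : List (Formula S)} {φ : Formula S}
    (h : Derivable (ψs : Multiset (Formula S)) (φ ::ₘ (φs : Multiset (Formula S)))) :
    Provable (conjPremise ψs) (OpLogic.disj φ φs) := by
  cases ψs with
  | nil => exact ⟨∅, by simp, by simpa using h.disj⟩
  | cons ψ l => exact ⟨{l.foldl Formula.and ψ}, by simp [conjPremise], h.disj.foldl_and⟩

/-! ### Rewriting with a set of equations -/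

open Classical in
/-- One rewriting step, from left to right, with an equation in `E` at some position. -/
def Step (E : ∀ s : S.Srt, Term S s → Term S s → Prop) :
    {s : S.Srt} → Term S s → Term S s → Prop
  | _, .var x, v => E _ (.var x) v
  | _, .const c, v => E _ (.const c) v
  | _, .func f ts, v => E _ (.func f ts) v ∨
      ∃ i t, Step E (ts i) t ∧ v = .func f (Function.update ts i t)

variable {E : ∀ s : S.Srt, Term S s → Term S s → Prop}

theorem Step.of_rel {s : S.Srt} {a b : Term S s} (h : E s a b) : Step E a b := by
  cases a with
  | var x => exact h
  | const c => exact h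
  | func f ts => exact .inl h

open Classical in
theorem Step.arg {f : S.F} (ts : ∀ i : Fin (S.funArgs f).length, Term S ((S.funArgs f).get i))
    (i) {a b : Term S ((S.funArgs f).get i)} (h : Step E a b) :
    Step E (.func f (Function.update ts i a)) (.func f (Function.update ts i b)) :=
  .inr ⟨i, b, by simpa using h, by simp⟩

/-- A rewriting step replaces one subterm, whose position is marked by a new variable. -/
theorem Step.exists_context {s : S.Srt} {u v : Term S s} (h : Step E u v) (B : Finset ℕ) :
    ∃ x ∉ B, ∃ (c : Term S s) (a b : Term S (S.varSort x)), E _ a b ∧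
      c.subst (Function.update Term.var x a) = u ∧
      c.subst (Function.update Term.var x b) = v := by
  classical
  have root : ∀ {s : S.Srt} {u v : Term S s} (B : Finset ℕ), E s u v →
      ∃ x ∉ B, ∃ (c : Term S s) (a b : Term S (S.varSort x)), E _ a b ∧
        c.subst (Function.update Term.var x a) = u ∧
        c.subst (Function.update Term.var x b) = v := by
    intro s u v B h
    obtain ⟨x, rfl, hx⟩ := S.exists_fresh s B
    exact ⟨x, hx, .var x, u, v, h, by simp [Term.subst], by simp [Term.subst]⟩
  induction u generalizing B with
  | var x => exact root B h
  | const c => exact root B h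
  | func f ts ih =>
    rcases h with h | ⟨i, t, h, rfl⟩
    · exact root B h
    -- The marker must also avoid the sibling arguments, so that substituting for it leaves them
    -- unchanged.
    · obtain ⟨x, hx, c, a, b, hE, hu, hv⟩ :=
        ih i h (B ∪ Finset.univ.biUnion fun j => (ts j).vars)
      simp only [Finset.mem_union, Finset.mem_biUnion, Finset.mem_univ, true_and, not_or,
        not_exists] at hx
      have aux : ∀ d, (Term.func f (Function.update ts i c)).subst
          (Function.update Term.var x d) =
          .func f (Function.update ts i (c.subst (Function.update Term.var x d))) := by
        intro d
        simp only [Term.subst]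
        congr 1
        funext j
        rcases eq_or_ne j i with rfl | hj
        · simp
        · simp only [Function.update_of_ne hj]
          exact Term.subst_update_of_notMem _ (hx.2 j) _
      exact ⟨x, hx.1, _, a, b, hE, by rw [aux, hu, Function.update_eq_self], by rw [aux, hv]⟩

open Relation in
/-- If the equations are closed under rewriting their left-hand sides, then every peak closes in
at most one step on either side. -/
theorem Step.strongly_confluent
    (hE : ∀ {s : S.Srt} {a b c : Term S s}, Step E a b → E s a c → E s b c)
    {s : S.Srt} {w u v : Term S s} (hu : Step E w u) (hv : Step E w v) :
    ∃ z, ReflGen (Step E) u z ∧ ReflGen (Step E) v z := by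
  classical
  induction w with
  | var x => exact ⟨v, .single (.of_rel (hE hu hv)), .refl⟩
  | const c => exact ⟨v, .single (.of_rel (hE hu hv)), .refl⟩
  | func f ts ih =>
    rcases id hu with hu' | ⟨i, a, hi, rfl⟩
    -- The root step uses the equation from `w` to `u`. Rewriting its left-hand side by the other
    -- step gives an equation from `v` to `u`.
    · exact ⟨u, .refl, .single (.of_rel (hE hv hu'))⟩
    rcases id hv with hv' | ⟨j, b, hj, rfl⟩
    · exact ⟨v, .single (.of_rel (hE hu hv')), .refl⟩
    rcases eq_or_ne i j with rfl | hij
    · obtain ⟨z, haz, hbz⟩ := ih i hi hj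
      have lift : ∀ {c}, ReflGen (Step E) c z → ReflGen (Step E)
          (.func f (Function.update ts i c)) (.func f (Function.update ts i z)) := by
        rintro _ (_ | h)
        · exact .refl
        · exact .single (Step.arg ts i h)
      exact ⟨_, lift haz, lift hbz⟩
    · refine ⟨.func f (Function.update (Function.update ts i a) j b), .single ?_, .single ?_⟩
      · exact .inr ⟨j, b, by rwa [Function.update_of_ne hij.symm], rfl⟩
      · exact .inr ⟨i, a, by rwa [Function.update_of_ne hij], by
          rw [Function.update_comm hij]⟩

open Relation in
-- Church–Rosser: this trades equational reasoning in both directions for rewriting from left to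
-- right, the only direction the substitution rules offer.
theorem join_of_eqvGen_step
    (hE : ∀ {s : S.Srt} {a b c : Term S s}, Step E a b → E s a c → E s b c)
    {s : S.Srt} {u v : Term S s} (h : EqvGen (Step E) u v) :
    Join (ReflTransGen (Step E)) u v := by
  have cr : ∀ a b c : Term S s, ReflTransGen (Step E) a b → ReflTransGen (Step E) a c →
      Join (ReflTransGen (Step E)) b c := fun a b c =>
    church_rosser fun a b c hb hc => by
      obtain ⟨z, h₁, h₂⟩ := Step.strongly_confluent hE hb hc
      exact ⟨z, h₁, h₂.to_reflTransGen⟩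
  induction h with
  | rel a b h => exact ⟨b, .single h, .refl⟩
  | refl a => exact ⟨a, .refl, .refl⟩
  | symm a b _ ih => exact ih.imp fun _ => And.symm
  | trans a b c _ _ ih₁ ih₂ =>
    obtain ⟨z, hz₁, hz₂⟩ := ih₁
    obtain ⟨w, hw₁, hw₂⟩ := ih₂
    obtain ⟨y, hy₁, hy₂⟩ := cr _ _ _ hz₂ hw₁
    exact ⟨y, hz₁.trans hy₁, hw₂.trans hy₂⟩

open Relation in
-- A step alters one argument only, so the arguments are exchanged one at a time, by induction on
-- the set of those already exchanged.
theorem eqvGen_step_func {f : S.F}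
    {ts ts' : ∀ i : Fin (S.funArgs f).length, Term S ((S.funArgs f).get i)}
    (h : ∀ i, EqvGen (Step E) (ts i) (ts' i)) :
    EqvGen (Step E) (.func f ts) (.func f ts') := by
  classical
  have one : ∀ (us : ∀ i, Term S ((S.funArgs f).get i)) (i) (a b : Term S ((S.funArgs f).get i)),
      EqvGen (Step E) a b → EqvGen (Step E) (.func f (Function.update us i a))
        (.func f (Function.update us i b)) := by
    intro us i a b hab
    induction hab with
    | rel a b h => exact .rel _ _ (Step.arg us i h)
    | refl a => exact .refl _
    | symm a b _ ih => exact ih.symm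
    | trans a b c _ _ ih₁ ih₂ => exact ih₁.trans _ _ _ ih₂
  have many : ∀ I : Finset (Fin (S.funArgs f).length),
      EqvGen (Step E) (.func f ts) (.func f (I.piecewise ts' ts)) := by
    intro I
    induction I using Finset.induction with
    | empty => simpa using EqvGen.refl _
    | insert i I hi ih =>
      refine ih.trans _ _ _ ?_
      rw [Finset.piecewise_insert]
      have := one (I.piecewise ts' ts) i (I.piecewise ts' ts i) (ts' i)
        (by rw [Finset.piecewise_eq_of_notMem _ _ _ hi]; exact h i)
      rwa [Function.update_eq_self] at this
  simpa using many Finset.univ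

/-! ### The ground term model -/

/-- Ground terms of a given sort. -/
abbrev GroundTerm (S : Signature) (s : S.Srt) : Type := {t : Term S s // t.IsGround}

/-- Ground terms modulo the congruence generated by `E`. -/
def groundSetoid (E : ∀ s : S.Srt, Term S s → Term S s → Prop) (s : S.Srt) :
    Setoid (GroundTerm S s) where
  r a b := Relation.EqvGen (Step E) a.1 b.1
  iseqv := ⟨fun _ => .refl _, fun h => h.symm, fun h₁ h₂ => h₁.trans _ _ _ h₂⟩

/-- The structure of ground terms modulo the congruence generated by `E`. -/
noncomputable def groundModel (E : ∀ s : S.Srt, Term S s → Term S s → Prop) :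
    Structure.{u} S where
  -- The lift places the model in the universe over which entailment quantifies.
  carrier s := ULift (Quotient (groundSetoid E s))
  nonempty s := let ⟨t, ht⟩ := exists_isGround s; ⟨⟨Quotient.mk _ ⟨t, ht⟩⟩⟩
  const c := ⟨Quotient.mk _ ⟨.const c, rfl⟩⟩
  func f as := ⟨Quotient.mk _ ⟨.func f fun i => (as i).down.out.1,
    Term.isGround_func.2 fun i => (as i).down.out.2⟩⟩

/-- Ground terms representing the values of an assignment in the ground term model. -/
noncomputable def representatives (M : Assignment (groundModel.{u} E)) : Subst S :=
  fun x => (ULift.down (M x)).out.1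

theorem isGround_representatives (M : Assignment (groundModel.{u} E)) (x : ℕ) :
    (representatives M x).IsGround :=
  (ULift.down (M x)).out.2

/-- The representatives chosen when interpreting a function symbol are convertible to the actual
arguments, and convertibility is a congruence. -/
theorem eval_groundModel (M : Assignment (groundModel.{u} E)) {s : S.Srt} (t : Term S s) :
    t.eval (groundModel.{u} E) M = ⟨Quotient.mk _ ⟨t.subst (representatives M),
      t.isGround_subst (isGround_representatives M)⟩⟩ := by
  induction t with
  | var x =>
    refine ULift.ext _ _ ?_
    exact (Quotient.out_eq (ULift.down (M x))).symm
  | const c => rfl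
  | func f ts ih =>
    simp only [Term.eval, ih]
    refine ULift.ext _ _ (Quotient.sound (s := groundSetoid E _) ?_)
    exact eqvGen_step_func fun i => Quotient.mk_out (s := groundSetoid E _) _

/-! ### Saturated pairs -/

/-- No sequent with left-hand side from `L` and right-hand side from `R` is derivable. -/
def Underivable (L R : Set (Formula S)) : Prop :=
  ∀ Γ Δ : Multiset (Formula S), (∀ φ ∈ Γ, φ ∈ L) → (∀ φ ∈ Δ, φ ∈ R) → ¬ Derivable Γ Δ

/-- An underivable pair that cannot be enlarged. -/
structure Saturated (L R : Set (Formula S)) : Prop where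
  underivable : Underivable L R
  mem_left : ∀ φ, Underivable (insert φ L) R → φ ∈ L
  mem_right : ∀ φ, Underivable L (insert φ R) → φ ∈ R

/-- A sequent has finitely many formulas, so underivability has finite character and Tukey's lemma
applies. Pairs are coded as sets of formulas tagged by their side. -/
theorem Underivable.exists_saturated {L R : Set (Formula S)} (h : Underivable L R) :
    ∃ L' R', L ⊆ L' ∧ R ⊆ R' ∧ Saturated L' R' := by
  classical
  let F : Set (Set (Formula S ⊕ Formula S)) :=
    {X | Underivable (Sum.inl ⁻¹' X) (Sum.inr ⁻¹' X)}
  have hF : Order.IsOfFiniteCharacter F := by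
    intro X
    refine ⟨fun hX Y hY _ Γ Δ hΓ hΔ => hX Γ Δ (fun φ hφ => hY (hΓ φ hφ)) fun φ hφ =>
      hY (hΔ φ hφ), fun H Γ Δ hΓ hΔ => ?_⟩
    refine H (Sum.inl '' {φ | φ ∈ Γ} ∪ Sum.inr '' {φ | φ ∈ Δ}) ?_ ?_ Γ Δ ?_ ?_
    · rintro _ (⟨φ, hφ, rfl⟩ | ⟨φ, hφ, rfl⟩)
      · exact hΓ φ hφ
      · exact hΔ φ hφ
    · exact ((Multiset.finite_toSet Γ).image _).union ((Multiset.finite_toSet Δ).image _)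
    · exact fun φ hφ => .inl ⟨φ, hφ, rfl⟩
    · exact fun φ hφ => .inr ⟨φ, hφ, rfl⟩
  have hmem : Sum.inl '' L ∪ Sum.inr '' R ∈ F := by
    intro Γ Δ hΓ hΔ
    refine h Γ Δ (fun φ hφ => ?_) fun φ hφ => ?_
    · simpa using hΓ φ hφ
    · simpa using hΔ φ hφ
  obtain ⟨X, hX, hmax⟩ := hF.exists_maximal hmem
  refine ⟨Sum.inl ⁻¹' X, Sum.inr ⁻¹' X, fun φ hφ => hX (.inl ⟨φ, hφ, rfl⟩),
    fun φ hφ => hX (.inr ⟨φ, hφ, rfl⟩), hmax.prop, fun φ hφ => ?_, fun φ hφ => ?_⟩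
  · refine hmax.le_of_ge (y := insert (Sum.inl φ) X) ?_ (Set.subset_insert _ _)
      (Set.mem_insert _ _)
    intro Γ Δ hΓ hΔ
    exact hφ Γ Δ (by simpa using hΓ) (by simpa using hΔ)
  · refine hmax.le_of_ge (y := insert (Sum.inr φ) X) ?_ (Set.subset_insert _ _)
      (Set.mem_insert _ _)
    intro Γ Δ hΓ hΔ
    exact hφ Γ Δ (by simpa using hΓ) (by simpa using hΔ)

/-! ### Closure of saturated pairs under the rules read upwards -/

namespace Saturated

variable {L R : Set (Formula S)}

/-- By maximality, adding `φ` makes some sequent derivable; its copies of `φ` are gathered into one,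
ready to be the active formula of a rule. -/
theorem exists_derivable_left (h : Saturated L R) {φ : Formula S} (hφ : φ ∉ L) :
    ∃ Γ Δ : Multiset (Formula S), (∀ ψ ∈ Γ, ψ ∈ L) ∧ (∀ ψ ∈ Δ, ψ ∈ R) ∧
      Derivable (φ ::ₘ Γ) Δ := by
  classical
  have := mt (h.mem_left φ) hφ
  simp only [Underivable, not_forall, not_not] at this
  obtain ⟨Γ, Δ, hΓ, hΔ, hd⟩ := this
  refine ⟨Γ.filter (· ≠ φ), Δ, fun ψ hψ => ?_, hΔ, hd.mono (fun ψ hψ => ?_) (fun _ => id)⟩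
  · rw [Multiset.mem_filter] at hψ
    exact (hΓ ψ hψ.1).resolve_left hψ.2
  · by_cases hne : ψ = φ <;> simp [hne, hψ]

theorem exists_derivable_right (h : Saturated L R) {φ : Formula S} (hφ : φ ∉ R) :
    ∃ Γ Δ : Multiset (Formula S), (∀ ψ ∈ Γ, ψ ∈ L) ∧ (∀ ψ ∈ Δ, ψ ∈ R) ∧
      Derivable Γ (φ ::ₘ Δ) := by
  classical
  have := mt (h.mem_right φ) hφ
  simp only [Underivable, not_forall, not_not] at this
  obtain ⟨Γ, Δ, hΓ, hΔ, hd⟩ := this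
  refine ⟨Γ, Δ.filter (· ≠ φ), hΓ, fun ψ hψ => ?_, hd.mono (fun _ => id) (fun ψ hψ => ?_)⟩
  · rw [Multiset.mem_filter] at hψ
    exact (hΔ ψ hψ.1).resolve_left hψ.2
  · by_cases hne : ψ = φ <;> simp [hne, hψ]

theorem not_derivable_cons (h : Saturated L R) {φ : Formula S} {Γ Δ : Multiset (Formula S)}
    (hφ : φ ∈ L) (hΓ : ∀ ψ ∈ Γ, ψ ∈ L) (hΔ : ∀ ψ ∈ Δ, ψ ∈ R) : ¬ Derivable (φ ::ₘ Γ) Δ :=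
  h.underivable _ _ (Multiset.forall_mem_cons.2 ⟨hφ, hΓ⟩) hΔ

theorem not_derivable_cons_right (h : Saturated L R) {φ : Formula S}
    {Γ Δ : Multiset (Formula S)} (hφ : φ ∈ R) (hΓ : ∀ ψ ∈ Γ, ψ ∈ L) (hΔ : ∀ ψ ∈ Δ, ψ ∈ R) :
    ¬ Derivable Γ (φ ::ₘ Δ) :=
  h.underivable _ _ hΓ (Multiset.forall_mem_cons.2 ⟨hφ, hΔ⟩)

theorem forall_mem_add {P : Set (Formula S)} {Γ Γ' : Multiset (Formula S)}
    (h : ∀ ψ ∈ Γ, ψ ∈ P) (h' : ∀ ψ ∈ Γ', ψ ∈ P) : ∀ ψ ∈ Γ + Γ', ψ ∈ P := fun ψ hψ =>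
  (Multiset.mem_add.1 hψ).elim (h ψ) (h' ψ)

theorem neg_left (h : Saturated L R) {φ : Formula S} (hφ : φ.neg ∈ L) : φ ∈ R := by
  by_contra hn
  obtain ⟨Γ, Δ, hΓ, hΔ, hd⟩ := h.exists_derivable_right hn
  exact h.not_derivable_cons hφ hΓ hΔ (hd.negL)

theorem neg_right (h : Saturated L R) {φ : Formula S} (hφ : φ.neg ∈ R) : φ ∈ L := by
  by_contra hn
  obtain ⟨Γ, Δ, hΓ, hΔ, hd⟩ := h.exists_derivable_left hn
  exact h.not_derivable_cons_right hφ hΓ hΔ (hd.negR)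

theorem or_left (h : Saturated L R) {φ ψ : Formula S} (hφ : φ.or ψ ∈ L) : φ ∈ L ∨ ψ ∈ L := by
  by_contra! hn
  obtain ⟨Γ, Δ, hΓ, hΔ, hd⟩ := h.exists_derivable_left hn.1
  obtain ⟨Γ', Δ', hΓ', hΔ', hd'⟩ := h.exists_derivable_left hn.2
  -- The two premises come with different contexts; both are weakened to the sum.
  refine h.not_derivable_cons hφ (forall_mem_add hΓ hΓ') (forall_mem_add hΔ hΔ') (.orL _ _ ?_ ?_)
  · exact hd.mono (Multiset.cons_subset_cons (fun _ h => by simp [h])) (fun _ h => by simp [h])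
  · exact hd'.mono (Multiset.cons_subset_cons (fun _ h => by simp [h])) (fun _ h => by simp [h])

theorem and_right (h : Saturated L R) {φ ψ : Formula S} (hφ : φ.and ψ ∈ R) :
    φ ∈ R ∨ ψ ∈ R := by
  by_contra! hn
  obtain ⟨Γ, Δ, hΓ, hΔ, hd⟩ := h.exists_derivable_right hn.1
  obtain ⟨Γ', Δ', hΓ', hΔ', hd'⟩ := h.exists_derivable_right hn.2
  refine h.not_derivable_cons_right hφ (forall_mem_add hΓ hΓ') (forall_mem_add hΔ hΔ')
    (.andR _ _ ?_ ?_)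
  · exact hd.mono (fun _ h => by simp [h]) (Multiset.cons_subset_cons (fun _ h => by simp [h]))
  · exact hd'.mono (fun _ h => by simp [h]) (Multiset.cons_subset_cons (fun _ h => by simp [h]))

theorem imp_left (h : Saturated L R) {φ ψ : Formula S} (hφ : φ.imp ψ ∈ L) : φ ∈ R ∨ ψ ∈ L := by
  by_contra! hn
  obtain ⟨Γ, Δ, hΓ, hΔ, hd⟩ := h.exists_derivable_right hn.1
  obtain ⟨Γ', Δ', hΓ', hΔ', hd'⟩ := h.exists_derivable_left hn.2
  refine h.not_derivable_cons hφ (forall_mem_add hΓ hΓ') (forall_mem_add hΔ hΔ')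
    (.impL _ _ ?_ ?_)
  · exact hd.mono (fun _ h => by simp [h]) (Multiset.cons_subset_cons (fun _ h => by simp [h]))
  · exact hd'.mono (Multiset.cons_subset_cons (fun _ h => by simp [h])) (fun _ h => by simp [h])

theorem and_left (h : Saturated L R) {φ ψ : Formula S} (hφ : φ.and ψ ∈ L) : φ ∈ L ∧ ψ ∈ L := by
  by_contra hn
  rw [not_and_or] at hn
  rcases hn with hn | hn
  · obtain ⟨Γ, Δ, hΓ, hΔ, hd⟩ := h.exists_derivable_left hn
    exact h.not_derivable_cons hφ hΓ hΔ
      (.andL _ _ (hd.mono (Multiset.cons_subset_cons (fun _ h => by simp [h])) (fun _ h => by simp [h])))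
  · obtain ⟨Γ, Δ, hΓ, hΔ, hd⟩ := h.exists_derivable_left hn
    exact h.not_derivable_cons hφ hΓ hΔ (.andL _ _ (hd.weakL _))

theorem or_right (h : Saturated L R) {φ ψ : Formula S} (hφ : φ.or ψ ∈ R) : φ ∈ R ∧ ψ ∈ R := by
  by_contra hn
  rw [not_and_or] at hn
  rcases hn with hn | hn
  · obtain ⟨Γ, Δ, hΓ, hΔ, hd⟩ := h.exists_derivable_right hn
    exact h.not_derivable_cons_right hφ hΓ hΔ
      (.orR _ _ (hd.mono (fun _ h => by simp [h]) (Multiset.cons_subset_cons (fun _ h => by simp [h]))))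
  · obtain ⟨Γ, Δ, hΓ, hΔ, hd⟩ := h.exists_derivable_right hn
    exact h.not_derivable_cons_right hφ hΓ hΔ (.orR _ _ (hd.weakR _))

theorem imp_right (h : Saturated L R) {φ ψ : Formula S} (hφ : φ.imp ψ ∈ R) :
    φ ∈ L ∧ ψ ∈ R := by
  by_contra hn
  rw [not_and_or] at hn
  rcases hn with hn | hn
  · obtain ⟨Γ, Δ, hΓ, hΔ, hd⟩ := h.exists_derivable_left hn
    exact h.not_derivable_cons_right hφ hΓ hΔ (.impR _ _ (hd.weakR _))
  · obtain ⟨Γ, Δ, hΓ, hΔ, hd⟩ := h.exists_derivable_right hn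
    exact h.not_derivable_cons_right hφ hΓ hΔ (.impR _ _ (hd.weakL _))

theorem subst_left (h : Saturated L R) {x : ℕ} {φ : Formula S} {a b : Term S (S.varSort x)}
    (hab : Formula.eq a b ∈ L) (hφ : φ.subst x a ∈ L) : φ.subst x b ∈ L := by
  by_contra hn
  obtain ⟨Γ, Δ, hΓ, hΔ, hd⟩ := h.exists_derivable_left hn
  exact h.not_derivable_cons hφ (Multiset.forall_mem_cons.2 ⟨hab, hΓ⟩) hΔ
    (.subL _ _ _ _ (hd.mono (Multiset.cons_subset_cons (fun _ h => by simp [h])) (fun _ h => by simp [h])))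

theorem subst_right (h : Saturated L R) {x : ℕ} {φ : Formula S} {a b : Term S (S.varSort x)}
    (hab : Formula.eq a b ∈ L) (hφ : φ.subst x a ∈ R) : φ.subst x b ∈ R := by
  by_contra hn
  obtain ⟨Γ, Δ, hΓ, hΔ, hd⟩ := h.exists_derivable_right hn
  exact h.not_derivable_cons_right hφ (Multiset.forall_mem_cons.2 ⟨hab, hΓ⟩) hΔ
    (.subR _ _ _ _ (hd.weakL _))

end Saturated

/-- The equations in a set of formulas. -/
def equations (L : Set (Formula S)) (s : S.Srt) (a b : Term S s) : Prop := Formula.eq a b ∈ L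

/-! ### Equations in saturated pairs and the truth lemma -/

namespace Saturated

variable {L R : Set (Formula S)}

/-- The marker of the rewritten position is new for `c`, so the substitution rule acts on the
left-hand side alone. This is the closure condition behind strong confluence. -/
theorem eq_left_of_step (h : Saturated L R) {s : S.Srt} {a b c : Term S s}
    (hab : Step (equations L) a b) (hac : Formula.eq a c ∈ L) : Formula.eq b c ∈ L := by
  obtain ⟨x, hx, d, p, q, hE, rfl, rfl⟩ := hab.exists_context c.vars
  have := h.subst_left (φ := .eq d c) hE
  simp only [Formula.subst, Formula.substAll, c.subst_update_of_notMem hx] at this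
  exact this hac

theorem eq_right_of_step (h : Saturated L R) {s : S.Srt} {a b c : Term S s}
    (hab : Step (equations L) a b) :
    (Formula.eq a c ∈ R → Formula.eq b c ∈ R) ∧ (Formula.eq c a ∈ R → Formula.eq c b ∈ R) := by
  obtain ⟨x, hx, d, p, q, hE, rfl, rfl⟩ := hab.exists_context c.vars
  have h₁ := h.subst_right (φ := .eq d c) hE
  have h₂ := h.subst_right (φ := .eq c d) hE
  simp only [Formula.subst, Formula.substAll, c.subst_update_of_notMem hx] at h₁ h₂
  exact ⟨h₁, h₂⟩

/-- Otherwise both sides rewrite to a common `z`, and following the reductions inside `R` yields `z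
≈ z`, an instance of reflexivity. -/
theorem not_eqvGen_of_eq_right (h : Saturated L R) {s : S.Srt} {a b : Term S s}
    (hab : Formula.eq a b ∈ R) : ¬ Relation.EqvGen (Step (equations L)) a b := by
  intro hc
  obtain ⟨z, ha, hb⟩ := join_of_eqvGen_step (fun h₁ h₂ => h.eq_left_of_step h₁ h₂) hc
  have hz : Formula.eq z b ∈ R := by
    clear hb hc
    induction ha with
    | refl => exact hab
    | tail _ h' ih => exact (h.eq_right_of_step h').1 ih
  have hzz : Formula.eq z z ∈ R := by
    have : ∀ c, Relation.ReflTransGen (Step (equations L)) b c → Formula.eq z c ∈ R := by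
      intro c hb
      induction hb with
      | refl => exact hz
      | tail _ h' ih => exact (h.eq_right_of_step h').2 ih
    exact this z hb
  exact h.not_derivable_cons_right hzz (Γ := 0) (Δ := 0) (by simp) (by simp) (.ref _ _ z)

/-- The ground term model satisfies what is on the left and refutes what is on the right. -/
theorem truth (h : Saturated L R) {φ : Formula S} (hφ : φ.QuantifierFree)
    (M : Assignment (groundModel.{u} (equations L))) :
    (φ.substAll (representatives M) ∈ L → φ.Holds _ M) ∧
      (φ.substAll (representatives M) ∈ R → ¬ φ.Holds _ M) := by
  induction φ with
  | eq a b =>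
    simp only [Formula.substAll, Formula.Holds, eval_groundModel]
    refine ⟨fun hL => ?_, fun hR he => h.not_eqvGen_of_eq_right hR ?_⟩
    · exact ULift.ext _ _ (Quotient.sound (s := groundSetoid _ _) (.rel _ _ (.of_rel hL)))
    · exact Quotient.exact (s := groundSetoid _ _) (congrArg ULift.down he)
  | neg φ ih =>
    obtain ⟨i₁, i₂⟩ := ih hφ
    exact ⟨fun hL => i₂ (h.neg_left hL), fun hR => not_not.2 (i₁ (h.neg_right hR))⟩
  | or φ ψ ih₁ ih₂ =>
    obtain ⟨⟨i₁, i₂⟩, j₁, j₂⟩ := And.intro (ih₁ hφ.1) (ih₂ hφ.2)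
    exact ⟨fun hL => (h.or_left hL).imp i₁ j₁,
      fun hR => not_or.2 ((h.or_right hR).imp i₂ j₂)⟩
  | and φ ψ ih₁ ih₂ =>
    obtain ⟨⟨i₁, i₂⟩, j₁, j₂⟩ := And.intro (ih₁ hφ.1) (ih₂ hφ.2)
    exact ⟨fun hL => (h.and_left hL).imp i₁ j₁,
      fun hR => not_and_or.2 ((h.and_right hR).imp i₂ j₂)⟩
  | imp φ ψ ih₁ ih₂ =>
    obtain ⟨⟨i₁, i₂⟩, j₁, j₂⟩ := And.intro (ih₁ hφ.1) (ih₂ hφ.2)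
    exact ⟨fun hL hH => (h.imp_left hL).elim (fun hR => (i₂ hR hH).elim) j₁,
      fun hR hH => j₂ (h.imp_right hR).2 (hH (i₁ (h.imp_right hR).1))⟩
  | ex x φ | all x φ => exact hφ.elim

end Saturated

/-- If `Φ ⊨ φ`, some sequent between the Herbrand expansions of `Φ` and `φ` is derivable. -/
theorem Entails.not_underivable {Φ : Set (Formula S)} {φ : Formula S}
    (hΦ : ∀ ψ ∈ Φ, ψ.IsSentence ∧ IsSkolem ψ) (hφ : φ.IsSentence ∧ IsHerbrand φ)
    (h : Entails.{u} Φ φ) : ¬ Underivable (herbrandSet Φ) (herbrand φ) := by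
  intro hu
  obtain ⟨L, R, hL, hR, hs⟩ := hu.exists_saturated
  obtain ⟨M⟩ : Nonempty (Assignment (groundModel.{u} (equations L))) :=
    ⟨fun x => ((groundModel.{u} (equations L)).nonempty _).some⟩
  have hM := h (groundModel (equations L)) M fun ψ hψ => by
    obtain ⟨hψs, hψk⟩ := hΦ ψ hψ
    -- Every element of the model is named by a ground term, so each value of the prefix variables
    -- corresponds to an instance in the expansion.
    refine (hψk.holds_iff M).2 fun M' _ => (hs.truth hψk.quantifierFree_matrix M').1 (hL ?_)
    exact Set.mem_biUnion hψ (substAll_matrix_mem_herbrand hψs hψk.quantifierFree_matrix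
      (isGround_representatives M'))
  obtain ⟨M', -, hM'⟩ := (hφ.2.holds_iff M).1 hM
  exact (hs.truth hφ.2.quantifierFree_matrix M').2 (hR (substAll_matrix_mem_herbrand hφ.1
    hφ.2.quantifierFree_matrix (isGround_representatives M'))) hM'

end OpLogic

theorem corollary2p4 (S : OpLogic.Signature) (Φ : Set (OpLogic.Formula S))
    (φ : OpLogic.Formula S)
    (hΦ : ∀ ψ ∈ Φ, ψ.IsSentence ∧ OpLogic.IsSkolem ψ)
    (hφ : φ.IsSentence ∧ OpLogic.IsHerbrand φ) :
    OpLogic.Entails.{u} Φ φ ↔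
      ∃ (ψs : List (OpLogic.Formula S)) (φ₁ : OpLogic.Formula S)
        (φs : List (OpLogic.Formula S)),
        (∀ ψ ∈ ψs, ψ ∈ OpLogic.herbrandSet Φ) ∧
        (∀ χ ∈ φ₁ :: φs, χ ∈ OpLogic.herbrand φ) ∧
        OpLogic.Provable (OpLogic.conjPremise ψs) (OpLogic.disj φ₁ φs) := by
  constructor
  · intro h
    have hu := h.not_underivable hΦ hφ
    simp only [OpLogic.Underivable, not_forall, not_not] at hu
    obtain ⟨Γ, Δ, hΓ, hΔ, hd⟩ := hu
    obtain ⟨ψs, rfl⟩ := Quotient.exists_rep Γ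
    obtain ⟨φs, rfl⟩ := Quotient.exists_rep Δ
    -- The right-hand side found may be empty; an arbitrary instance is added by weakening to ensure
    -- at least one disjunct.
    obtain ⟨φ₁, hφ₁⟩ := OpLogic.herbrand_nonempty hφ.1 hφ.2.quantifierFree_matrix
    exact ⟨ψs, φ₁, φs, hΓ, List.forall_mem_cons.2 ⟨hφ₁, hΔ⟩, (hd.weakR φ₁).provable⟩
  · rintro ⟨ψs, φ₁, φs, hψ, hχ, hp⟩ A M hM
    have hψ' : ∀ χ ∈ ψs, χ.QuantifierFree ∧ χ.Holds A M := by
      intro χ hχ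
      obtain ⟨ψ, hψΦ, hχψ⟩ := Set.mem_iUnion₂.1 (hψ χ hχ)
      have hk := (hΦ ψ hψΦ).2
      refine ⟨?_, hk.holds_of_mem_herbrand (hM ψ hψΦ) hχψ⟩
      obtain ⟨θ, -, -, rfl⟩ := hχψ
      exact OpLogic.Formula.quantifierFree_substAll.2 hk.quantifierFree_matrix
    obtain ⟨χ, hmem, hH⟩ := hp.sound (fun χ hχ => (hψ' χ hχ).1) (fun χ hmem => by
      obtain ⟨θ, -, -, rfl⟩ := hχ χ hmem
      exact OpLogic.Formula.quantifierFree_substAll.2 hφ.2.quantifierFree_matrix) A M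
      fun χ hχ => (hψ' χ hχ).2
    exact hφ.2.holds_of_mem_herbrand (hχ χ hmem) hH
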